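/- Let $n\ge 3$ and let $\rho_1,\dots,\rho_n\in(0,1)$ satisfy $\sum_{i=1}^n\rho_i<1$. For subsets $E,F$ of $\mathbb R$ write $E\sim F$ if there are a bijection $f:E\to F$ and constants $c,c'>0$ with $c|x-y|\le|f(x)-f(y)|\le c'|x-y|$ for all $x,y\in E$. The attractor of finitely many contractions $\Phi_1,\dots,\Phi_n$ of $\mathbb R$ is the unique nonempty compact set $E\subset\mathbb R$ with $E=\bigcup_{i=1}^n\Phi_i(E)$. Let $D\subset\mathbb R$ be a dust-like self-similar set with contraction vector $(\rho_1,\dots,\rho_n)$, that is, the attractor of similitudes $\Phi_1,\dots,\Phi_n$ of $\mathbb R$ with $|\Phi_i(x)-\Phi_i(y)|=\rho_i|x-y|$ such that $\Phi_i(D)\cap\Phi_j(D)=\emptyset$ for $i\ne j$. Let $T\subset\mathbb R$ be the attractor of maps $\Psi_i(x)=\rho_i x+t_i$, $1\le i\le n$, with the same ratios, such that 1. the intervals $\Psi_1([0,1]),\dots,\Psi_n([0,1])$ are arranged from left to right with pairwise disjoint interiors, i.e. $\Psi_i(1)\le\Psi_j(0)$ for $i<j$; 2. $\Psi_1(0)=0$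 and $\Psi_n(1)=1$; 3. $\Psi_i(1)=\Psi_{i+1}(0)$ for at least one $i\in\{1,\dots,n-1\}$. If $D\sim T$, then $\dfrac{\log\rho_1}{\log\rho_n}\in\mathbb Q$. -/

import Mathlib

/-- Lipschitz equivalence `E ∼ F` of two subsets of metric spaces: there is a bijection
`f : E → F` with `c |x - y| ≤ |f x - f y| ≤ c' |x - y|` for some constants `c, c' > 0`. -/
def LipschitzEquivalent {X Y : Type*} [MetricSpace X] [MetricSpace Y]
    (E : Set X) (F : Set Y) : Prop :=
  ∃ f : E → F, Function.Bijective f ∧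
    ∃ c c' : ℝ, 0 < c ∧ 0 < c' ∧
      ∀ x y : E, c * dist x y ≤ dist (f x) (f y) ∧ dist (f x) (f y) ≤ c' * dist x y

/-- `E` is the attractor of the family `Φ`: the nonempty compact set with `⋃ i, Φ i (E) = E`
(it exists and is unique when the `Φ i` are contractions). -/
def IsAttractor {n : ℕ} (Φ : Fin n → ℝ → ℝ) (E : Set ℝ) : Prop :=
  E.Nonempty ∧ IsCompact E ∧ ⋃ i, Φ i '' E = E

/-- `ρ` is a (separable) contraction vector in `ℝ`. -/
def IsContractionVector {n : ℕ} (ρ : Fin n → ℝ) : Prop :=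
  (∀ i, 0 < ρ i ∧ ρ i < 1) ∧ ∑ i, ρ i < 1

/-- The family of all dust-like self-similar subsets of `ℝ` with contraction vector `ρ`:
attractors of similitudes `Φ i` of ratio `ρ i` (orientation reversing ones are allowed) that
satisfy the strong separation condition. -/
def dustLikeFamily {n : ℕ} (ρ : Fin n → ℝ) : Set (Set ℝ) :=
  {E | ∃ Φ : Fin n → ℝ → ℝ,
    (∀ i x y, dist (Φ i x) (Φ i y) = ρ i * dist x y) ∧
    IsAttractor Φ E ∧
    ∀ i j, i ≠ j → Φ i '' E ∩ Φ j '' E = ∅}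

/-- The affine maps `Ψ i (x) = ρ i * x + t i`. -/
def affineIFS {n : ℕ} (ρ t : Fin n → ℝ) (i : Fin n) (x : ℝ) : ℝ :=
  ρ i * x + t i

/-- The maps `Ψ i (x) = ρ i * x + t i` form a touching system on `[0,1]`. The branches are
numbered `0, …, n - 1`, and `Ψ i ([0,1]) = [Ψ i (0), Ψ i (1)]` for `ρ i > 0`. -/
structure IsTouchingIFS {n : ℕ} (ρ t : Fin n → ℝ) : Prop where
  /-- The intervals `Ψ i ([0,1])` lie from left to right, with disjoint interiors. -/
  ordered : ∀ i j : Fin n, i < j → affineIFS ρ t i 1 ≤ affineIFS ρ t j 0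
  /-- The left endpoint of the first interval is `0`. -/
  left_end : ∀ i : Fin n, (i : ℕ) = 0 → affineIFS ρ t i 0 = 0
  /-- The right endpoint of the last interval is `1`. -/
  right_end : ∀ i : Fin n, (i : ℕ) + 1 = n → affineIFS ρ t i 1 = 1
  /-- At least one pair of consecutive intervals is touching. -/
  touching : ∃ i j : Fin n, (j : ℕ) = (i : ℕ) + 1 ∧ affineIFS ρ t i 1 = affineIFS ρ t j 0

/-!
Let `s` be the common similarity dimension, `∑ ρ i ^ s = 1`, and `p i = ρ i ^ s`. The natural
measure of the dust-like set `D` gives mass `∏ p` to the cylinder of a word. Let `ν` be its image on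
`T` under the bi-Lipschitz bijection (`exists_transported_measure`). Two properties of `ν` are
opposed to each other.

*Finitely many ratios.* The pullback to `D` of a piece of `T` whose diameter and distance to the
rest of `T` are comparable is a union of cylinders at a bounded depth below the smallest cylinder
containing it. Hence the ratios `ν B' / ν B` of such pieces `B' ⊆ B` of comparable size lie in a
finite set `Γ` (`IsBilipschitzCoding.exists_finite_ratios`).

*Asymptotic self-similarity.* The density `ν (Ψ_w [0,1]) / p_w` is bounded over all words `w`. Along
words `w` whose density tends to its supremum, `ν` on `Ψ_w (T)`, divided by `p_w`, converges to a
multiple of the self-similar measure of `T` (`exists_extremal_words`); being finite, `Γ` therefore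
also contains the corresponding ratios of self-similar masses.

As `∑ ρ i < 1`, the set `T` has a gap between two first-level intervals. Let `Ψ i 1 = Ψ j 0` be a
touching point, and let `e`, `f` be the last and the first branch. Cutting `Ψ i Ψ_e^k (T)` and
`Ψ j Ψ_f^l (T)` at the copies of the gap gives a separated piece around the touching point, of
self-similar mass `A * p e ^ k + B * p f ^ l` with `A, B > 0`. For every `k` choose `l = l k` such
that `ρ f ^ l` is comparable to `ρ e ^ k`. The quotient of the masses for `(k + 1, l)` and `(k, l)`
lies in `Γ` for every `k`, so it takes some value twice, and it is an injective function of
`p e ^ k / p f ^ l`. This gives `p e ^ k * p f ^ l' = p e ^ k' * p f ^ l` with `k ≠ k'`, so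
`log ρ f / log ρ e` is rational.
-/

open MeasureTheory Filter Topology Set

/-! ### Coding a dust-like set by sequences -/

/-- A bi-Lipschitz coding of a set by sequences: two sequences with longest common prefix `v` have
images at a distance between `c * ρ_v` and `C * ρ_v`, where `ρ_v` is the product of the ratios of
the letters of `v`. -/
def IsBilipschitzCoding {n : ℕ} (ρ : Fin n → ℝ) (τ : (ℕ → Fin n) → ℝ) (c C : ℝ) : Prop :=
  ∀ (σ σ' : ℕ → Fin n) (m : ℕ), (∀ i < m, σ' i = σ i) →
    |τ σ - τ σ'| ≤ C * ∏ i ∈ Finset.range m, ρ (σ i) ∧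
    (σ m ≠ σ' m → c * ∏ i ∈ Finset.range m, ρ (σ i) ≤ |τ σ - τ σ'|)

/-- The composition `Φ (σ 0) ∘ ⋯ ∘ Φ (σ (m - 1))`. -/
def prefixMap {n : ℕ} (Φ : Fin n → ℝ → ℝ) (σ : ℕ → Fin n) : ℕ → ℝ → ℝ
  | 0 => id
  | m + 1 => prefixMap Φ σ m ∘ Φ (σ m)

theorem dist_prefixMap {n : ℕ} {ρ : Fin n → ℝ} {Φ : Fin n → ℝ → ℝ}
    (hΦ : ∀ i x y, dist (Φ i x) (Φ i y) = ρ i * dist x y) (σ : ℕ → Fin n) (m : ℕ) (x y : ℝ) :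
    dist (prefixMap Φ σ m x) (prefixMap Φ σ m y)
      = (∏ i ∈ Finset.range m, ρ (σ i)) * dist x y := by
  induction m generalizing x y with
  | zero => simp [prefixMap]
  | succ m ih => simp [prefixMap, ih, hΦ, Finset.prod_range_succ, mul_assoc]

theorem prefixMap_congr {n : ℕ} (Φ : Fin n → ℝ → ℝ) {σ σ' : ℕ → Fin n} {m : ℕ}
    (h : ∀ i < m, σ' i = σ i) : prefixMap Φ σ' m = prefixMap Φ σ m := by
  induction m with
  | zero => rfl
  | succ m ih =>
    simp only [prefixMap]
    rw [ih fun i hi => h i (by omega), h m (by omega)]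

theorem exists_pos_le_dist_of_disjoint {K L : Set ℝ} (hK : IsCompact K) (hL : IsCompact L)
    (h : K ∩ L = ∅) : ∃ δ > 0, ∀ x ∈ K, ∀ y ∈ L, δ ≤ dist x y := by
  rcases (K ×ˢ L).eq_empty_or_nonempty with he | hne
  · refine ⟨1, one_pos, fun x hx y hy => ?_⟩
    have : (x, y) ∈ K ×ˢ L := ⟨hx, hy⟩
    simp [he] at this
  · obtain ⟨z, hz, hmin⟩ := (hK.prod hL).exists_isMinOn hne
      (continuous_dist (α := ℝ)).continuousOn
    refine ⟨dist z.1 z.2, dist_pos.2 fun e => ?_,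
      fun x hx y hy => hmin (show (x, y) ∈ K ×ˢ L from ⟨hx, hy⟩)⟩
    have : z.1 ∈ K ∩ L := ⟨hz.1, e ▸ hz.2⟩
    simp [h] at this

/-- A dust-like set is coded by the sequences of branches, and a bi-Lipschitz bijection transports
the coding. -/
theorem exists_bilipschitzCoding {n : ℕ} {ρ : Fin n → ℝ} {D T : Set ℝ} (hρ : ∀ i, 0 < ρ i)
    (hD : D ∈ dustLikeFamily ρ) (hDT : LipschitzEquivalent D T) :
    ∃ (τ : (ℕ → Fin n) → ℝ) (c C : ℝ), 0 < c ∧ 0 < C ∧ (∀ σ, τ σ ∈ T) ∧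
      IsBilipschitzCoding ρ τ c C := by
  obtain ⟨Φ, hΦ, ⟨⟨x₀, hx₀⟩, hDc, hDU⟩, hdisj⟩ := hD
  obtain ⟨f, -, c, c', hc, hc', hf⟩ := hDT
  have hmaps : ∀ i x, x ∈ D → Φ i x ∈ D := fun i x hx => by
    rw [← hDU]; exact mem_iUnion.2 ⟨i, x, hx, rfl⟩
  have hcont : ∀ i, Continuous (Φ i) := fun i =>
    (LipschitzWith.of_dist_le_mul (K := ⟨ρ i, (hρ i).le⟩) fun x y => (hΦ i x y).le).continuous
  have hpcont : ∀ σ m, Continuous (prefixMap Φ σ m) := fun σ m => by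
    induction m with
    | zero => exact continuous_id
    | succ m ih => exact ih.comp (hcont _)
  have hsep : ∀ q : Fin n × Fin n, ∃ δ > 0, q.1 ≠ q.2 →
      ∀ x ∈ D, ∀ y ∈ D, δ ≤ dist (Φ q.1 x) (Φ q.2 y) := fun q => by
    by_cases hq : q.1 = q.2
    · exact ⟨1, one_pos, fun h => absurd hq h⟩
    · obtain ⟨δ, hδ, h⟩ := exists_pos_le_dist_of_disjoint (hDc.image (hcont q.1))
        (hDc.image (hcont q.2)) (hdisj _ _ hq)
      exact ⟨δ, hδ, fun _ x hx y hy => h _ ⟨x, hx, rfl⟩ _ ⟨y, hy, rfl⟩⟩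
  choose δ hδ hsep using hsep
  have hne : Nonempty (Fin n) := by
    rw [← hDU] at hx₀
    exact ⟨(mem_iUnion.1 hx₀).choose⟩
  obtain ⟨q₀, hq₀⟩ := Finite.exists_min δ
  have hpt : ∀ σ : ℕ → Fin n, ∃ x, ∀ m, x ∈ prefixMap Φ σ m '' D := fun σ => by
    have := IsCompact.nonempty_iInter_of_sequence_nonempty_isCompact_isClosed
      (fun m => prefixMap Φ σ m '' D)
      (fun m => by
        rintro _ ⟨x, hx, rfl⟩
        exact ⟨Φ (σ m) x, hmaps _ _ hx, rfl⟩)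
      (fun m => ⟨_, x₀, hx₀, rfl⟩) (hDc.image (hpcont σ 0))
      (fun m => (hDc.image (hpcont σ m)).isClosed)
    obtain ⟨x, hx⟩ := this
    exact ⟨x, mem_iInter.1 hx⟩
  choose π hπ using hpt
  have hπD : ∀ σ, π σ ∈ D := fun σ => by simpa [prefixMap] using hπ σ 0
  have hdiam : 0 < Metric.diam D + 1 := by positivity
  refine ⟨fun σ => f ⟨π σ, hπD σ⟩, c * δ q₀, c' * (Metric.diam D + 1), mul_pos hc (hδ _),
    mul_pos hc' hdiam, fun σ => (f _).2, fun σ σ' m h => ?_⟩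
  have hprod : 0 < ∏ i ∈ Finset.range m, ρ (σ i) := Finset.prod_pos fun i _ => hρ _
  have key := hf ⟨π σ, hπD σ⟩ ⟨π σ', hπD σ'⟩
  simp only [Subtype.dist_eq] at key
  rw [← Real.dist_eq]
  constructor
  · obtain ⟨x, hx, hx'⟩ := hπ σ m
    obtain ⟨y, hy, hy'⟩ := hπ σ' m
    rw [prefixMap_congr Φ h] at hy'
    have e : dist (π σ) (π σ') = (∏ i ∈ Finset.range m, ρ (σ i)) * dist x y := by
      rw [← hx', ← hy', dist_prefixMap hΦ]
    have hd : dist x y ≤ Metric.diam D + 1 :=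
      (Metric.dist_le_diam_of_mem hDc.isBounded hx hy).trans (by linarith)
    calc _ ≤ c' * dist (π σ) (π σ') := key.2
      _ ≤ c' * ((∏ i ∈ Finset.range m, ρ (σ i)) * (Metric.diam D + 1)) := by
        rw [e]; gcongr
      _ = _ := by ring
  · intro hm
    obtain ⟨x, hx, hx'⟩ := hπ σ (m + 1)
    obtain ⟨y, hy, hy'⟩ := hπ σ' (m + 1)
    simp only [prefixMap, Function.comp] at hx' hy'
    rw [prefixMap_congr Φ h] at hy'
    have e : dist (π σ) (π σ')
        = (∏ i ∈ Finset.range m, ρ (σ i)) * dist (Φ (σ m) x) (Φ (σ' m) y) := by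
      rw [← hx', ← hy', dist_prefixMap hΦ]
    have hd : δ q₀ ≤ dist (Φ (σ m) x) (Φ (σ' m) y) :=
      (hq₀ _).trans (hsep (σ m, σ' m) hm x hx y hy)
    calc c * δ q₀ * ∏ i ∈ Finset.range m, ρ (σ i)
        = c * ((∏ i ∈ Finset.range m, ρ (σ i)) * δ q₀) := by ring
      _ ≤ c * dist (π σ) (π σ') := by rw [e]; gcongr
      _ ≤ _ := key.1

/-! ### Bernoulli measures and continuity of the coding -/

theorem exists_bernoulli {n : ℕ} {p : Fin n → ℝ} (hp : ∀ i, 0 < p i) (hsum : ∑ i, p i = 1) :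
    ∃ P : Measure (ℕ → Fin n), IsProbabilityMeasure P ∧
      ∀ (σ : ℕ → Fin n) m, P.real {σ' | ∀ i < m, σ' i = σ i} = ∏ i ∈ Finset.range m, p (σ i) := by
  have h1 : ∑ i, ENNReal.ofReal (p i) = 1 := by
    rw [← ENNReal.ofReal_sum_of_nonneg fun i _ => (hp i).le, hsum, ENNReal.ofReal_one]
  let μ : Measure (Fin n) := (PMF.ofFintype (fun i => ENNReal.ofReal (p i)) h1).toMeasure
  refine ⟨Measure.infinitePi fun _ : ℕ => μ, inferInstance, fun σ m => ?_⟩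
  have e : {σ' : ℕ → Fin n | ∀ i < m, σ' i = σ i}
      = Set.pi (Finset.range m : Set ℕ) fun i => {σ i} := by
    ext σ'; simp [Set.mem_pi]
  rw [e, measureReal_def, Measure.infinitePi_pi _ fun i _ => measurableSet_singleton _,
    ENNReal.toReal_prod]
  refine Finset.prod_congr rfl fun i _ => ?_
  simp only [μ]
  rw [PMF.toMeasure_apply_singleton _ _ (measurableSet_singleton _), PMF.ofFintype_apply,
    ENNReal.toReal_ofReal (hp _).le]

theorem exists_uniform_lt_one {n : ℕ} {ρ : Fin n → ℝ} (hρ : ∀ i, 0 < ρ i ∧ ρ i < 1) :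
    ∃ q : ℝ, 0 < q ∧ q < 1 ∧
      ∀ (σ : ℕ → Fin n) m, ∏ i ∈ Finset.range m, ρ (σ i) ≤ q ^ m := by
  rcases isEmpty_or_nonempty (Fin n) with h | h
  · exact ⟨1 / 2, by norm_num, by norm_num, fun σ => isEmptyElim (σ 0)⟩
  · obtain ⟨i, hi⟩ := Finite.exists_max ρ
    refine ⟨ρ i, (hρ i).1, (hρ i).2, fun σ m => ?_⟩
    calc _ ≤ ∏ _j ∈ Finset.range m, ρ i :=
          Finset.prod_le_prod (fun j _ => (hρ _).1.le) fun j _ => hi _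
      _ = _ := by simp

theorem IsBilipschitzCoding.continuous {n : ℕ} {ρ : Fin n → ℝ} {τ : (ℕ → Fin n) → ℝ} {c C : ℝ}
    (hτ : IsBilipschitzCoding ρ τ c C) (hρ : ∀ i, 0 < ρ i ∧ ρ i < 1) (hC : 0 < C) :
    Continuous τ := by
  obtain ⟨q, hq0, hq1, hq⟩ := exists_uniform_lt_one hρ
  refine continuous_iff_continuousAt.2 fun σ => Metric.tendsto_nhds.2 fun ε hε => ?_
  obtain ⟨m, hm⟩ := exists_pow_lt_of_lt_one (div_pos hε hC) hq1
  have hopen : IsOpen (PiNat.cylinder σ m) := PiNat.isOpen_cylinder _ σ m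
  filter_upwards [hopen.mem_nhds (PiNat.self_mem_cylinder σ m)] with σ' hσ'
  rw [dist_comm, Real.dist_eq]
  calc _ ≤ C * ∏ i ∈ Finset.range m, ρ (σ i) :=
        (hτ σ σ' m fun i hi => PiNat.mem_cylinder_iff.1 hσ' i hi).1
    _ ≤ C * q ^ m := by gcongr; exact hq σ m
    _ < ε := by rwa [lt_div_iff₀' hC] at hm

/-! ### Finitely many relative masses of separated pieces -/

section FiniteTypes

variable {n : ℕ} {ρ p : Fin n → ℝ} {τ : (ℕ → Fin n) → ℝ} {c C : ℝ} {P : Measure (ℕ → Fin n)}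
  [IsProbabilityMeasure P]

/-- A set of sequences of positive measure whose image has diameter at most `r` lies in a cylinder
of ratio at most `r / c`, namely the smallest cylinder containing it. -/
theorem IsBilipschitzCoding.exists_cylinder (hτ : IsBilipschitzCoding ρ τ c C)
    (hp : ∀ i, 0 < p i ∧ p i < 1)
    (hP : ∀ (σ : ℕ → Fin n) m,
      P.real {σ' | ∀ i < m, σ' i = σ i} = ∏ i ∈ Finset.range m, p (σ i))
    {E : Set (ℕ → Fin n)} {r : ℝ} (hE : 0 < P.real E)
    (hr : ∀ σ ∈ E, ∀ σ' ∈ E, |τ σ - τ σ'| ≤ r) :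
    ∃ (σ : ℕ → Fin n) (m : ℕ), E ⊆ {σ' | ∀ i < m, σ' i = σ i} ∧
      c * ∏ i ∈ Finset.range m, ρ (σ i) ≤ r := by
  classical
  obtain ⟨σ, hσ⟩ : E.Nonempty := by
    rw [nonempty_iff_ne_empty]; rintro rfl; simp at hE
  have hex : ∃ m, ¬ E ⊆ {σ' | ∀ i < m, σ' i = σ i} := by
    by_contra! h
    obtain ⟨q, hq0, hq1, hq⟩ := exists_uniform_lt_one hp
    obtain ⟨m, hm⟩ := exists_pow_lt_of_lt_one hE hq1
    have := (measureReal_mono (μ := P) (h m)).trans ((hP σ m).le.trans (hq σ m))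
    linarith
  obtain ⟨m, hm, hmin⟩ : ∃ m, ¬ E ⊆ {σ' | ∀ i < m, σ' i = σ i} ∧
      ∀ k < m, E ⊆ {σ' | ∀ i < k, σ' i = σ i} :=
    ⟨Nat.find hex, Nat.find_spec hex, fun k hk => not_not.1 (Nat.find_min hex hk)⟩
  obtain _ | m := m
  · exact absurd (fun _ _ i hi => absurd hi (Nat.not_lt_zero i)) hm
  refine ⟨σ, m, hmin m (Nat.lt_succ_self m), ?_⟩
  obtain ⟨σ', hσ', hne⟩ := not_subset.1 hm
  have hag := hmin m (Nat.lt_succ_self m) hσ'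
  refine ((hτ σ σ' m hag).2 fun he => hne fun i hi => ?_).trans (hr σ hσ σ' hσ')
  rcases Nat.lt_succ_iff_lt_or_eq.1 hi with h | rfl
  exacts [hag i h, he.symm]

/-- The sequence that follows `σ` up to time `m`, then the word `u`; its values from time `m + K`
on play no role and are those of `σ`. -/
def spliceWord (σ : ℕ → Fin n) (m : ℕ) {K : ℕ} (u : Fin K → Fin n) (i : ℕ) : Fin n :=
  if m ≤ i then if h : i - m < K then u ⟨i - m, h⟩ else σ i else σ i

/-- A subset of a cylinder that is a union of subcylinders `K` levels deeper has relative measure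
in the finite set of subsums of the products of `K` weights. -/
theorem exists_measureReal_eq_sum
    (hP : ∀ (σ : ℕ → Fin n) m,
      P.real {σ' | ∀ i < m, σ' i = σ i} = ∏ i ∈ Finset.range m, p (σ i))
    {E : Set (ℕ → Fin n)} {σ : ℕ → Fin n} {m : ℕ} (hE : E ⊆ {σ' | ∀ i < m, σ' i = σ i}) (K : ℕ)
    (hsplit : ∀ σ₁ ∈ E, ∀ σ₂, (∀ i < m + K, σ₂ i = σ₁ i) → σ₂ ∈ E) :
    ∃ U : Finset (Fin K → Fin n),
      P.real E = (∏ i ∈ Finset.range m, p (σ i)) * ∑ u ∈ U, ∏ j, p (u j) := by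
  classical
  let cyl : (Fin K → Fin n) → Set (ℕ → Fin n) :=
    fun u => {σ' | ∀ i < m + K, σ' i = spliceWord σ m u i}
  have hlt : ∀ u : Fin K → Fin n, ∀ i < m, spliceWord σ m u i = σ i := fun u i hi => by
    simp [spliceWord, not_le.2 hi]
  have hge : ∀ (u : Fin K → Fin n) (j : Fin K), spliceWord σ m u (m + j) = u j := fun u j => by
    simp [spliceWord]
  have hmeas : ∀ u, MeasurableSet (cyl u) := fun u => by
    have : cyl u = ⋂ i ∈ Finset.range (m + K),
        (fun σ' : ℕ → Fin n => σ' i) ⁻¹' {spliceWord σ m u i} := by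
      ext; simp [cyl]
    rw [this]
    exact Finset.measurableSet_biInter _ fun i _ =>
      measurable_pi_apply i (measurableSet_singleton _)
  refine ⟨Finset.univ.filter fun u => cyl u ⊆ E, ?_⟩
  have hEU : E = ⋃ u ∈ Finset.univ.filter (fun u => cyl u ⊆ E), cyl u := by
    ext σ'
    simp only [Finset.mem_filter, Finset.mem_univ, true_and, mem_iUnion, exists_prop]
    refine ⟨fun h => ⟨fun j => σ' (m + j), ?_, ?_⟩, fun ⟨u, hu, h⟩ => hu h⟩
    all_goals
      have hs : ∀ i < m + K, spliceWord σ m (fun j : Fin K => σ' (m + j)) i = σ' i := by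
        intro i hi
        rcases lt_or_ge i m with h' | h'
        · rw [hlt _ _ h', hE h i h']
        · obtain ⟨j, rfl⟩ := Nat.exists_eq_add_of_le h'
          exact hge _ ⟨j, by omega⟩
    · exact fun σ₂ h₂ => hsplit σ' h σ₂ fun i hi => (h₂ i hi).trans (hs i hi)
    · exact fun i hi => (hs i hi).symm
  rw [hEU, measureReal_biUnion_finset ?_ fun u _ => hmeas u, ← hEU, Finset.mul_sum]
  · refine Finset.sum_congr rfl fun u _ => ?_
    rw [hP, Finset.prod_range_add, Finset.prod_range fun j => p (spliceWord σ m u (m + j))]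
    congr 1
    · exact Finset.prod_congr rfl fun i hi => by rw [hlt u i (Finset.mem_range.1 hi)]
    · exact Finset.prod_congr rfl fun j _ => by rw [hge]
  · intro u _ u' _ huu'
    refine Set.disjoint_left.2 fun σ' h h' => huu' (funext fun j => ?_)
    rw [← hge u j, ← hge u' j, ← h (m + j) (by omega), ← h' (m + j) (by omega)]

/-- Up to scaling, the sets of diameter at most `r` which are `κ * r`-separated from the rest of
the coded set are unions of cylinders of a bounded number of shapes. -/
theorem IsBilipschitzCoding.exists_finite_ratios (hτ : IsBilipschitzCoding ρ τ c C) (hc : 0 < c)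
    (hC : 0 < C) (hρ : ∀ i, 0 < ρ i ∧ ρ i < 1) (hp : ∀ i, 0 < p i ∧ p i < 1)
    (hP : ∀ (σ : ℕ → Fin n) m,
      P.real {σ' | ∀ i < m, σ' i = σ i} = ∏ i ∈ Finset.range m, p (σ i))
    {κ : ℝ} (hκ : 0 < κ) :
    ∃ Γ : Set ℝ, Γ.Finite ∧ ∀ (r : ℝ) (E E' : Set (ℕ → Fin n)), 0 < r → E' ⊆ E →
      (∀ σ ∈ E, ∀ σ' ∈ E, |τ σ - τ σ'| ≤ r) →
      (∀ σ ∈ E, ∀ σ' ∉ E, κ * r ≤ |τ σ - τ σ'|) →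
      (∀ σ ∈ E', ∀ σ' ∉ E', κ * r ≤ |τ σ - τ σ'|) →
      0 < P.real E → P.real E' / P.real E ∈ Γ := by
  obtain ⟨q, hq0, hq1, hq⟩ := exists_uniform_lt_one hρ
  obtain ⟨K, hK⟩ := exists_pow_lt_of_lt_one (show 0 < κ * c / C by positivity) hq1
  refine ⟨range fun U : Finset (Fin K → Fin n) × Finset (Fin K → Fin n) =>
    (∑ u ∈ U.1, ∏ j, p (u j)) / ∑ u ∈ U.2, ∏ j, p (u j), finite_range _, ?_⟩
  intro r E E' hr hsub hdiam hsep hsep' hpos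
  obtain ⟨σ, m, hcyl, hm⟩ := hτ.exists_cylinder hp hP hpos hdiam
  -- Sequences of the cylinder of `σ` agreeing for `K` more letters are too close to be separated.
  have hclose : ∀ σ₁ ∈ E, ∀ σ₂, (∀ i < m + K, σ₂ i = σ₁ i) → |τ σ₁ - τ σ₂| < κ * r := by
    intro σ₁ h₁ σ₂ h₂
    have e : ∏ i ∈ Finset.range m, ρ (σ₁ i) = ∏ i ∈ Finset.range m, ρ (σ i) :=
      Finset.prod_congr rfl fun i hi => by rw [hcyl h₁ i (Finset.mem_range.1 hi)]
    have h0 : 0 < ∏ i ∈ Finset.range m, ρ (σ i) := Finset.prod_pos fun i _ => (hρ _).1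
    calc |τ σ₁ - τ σ₂| ≤ C * ∏ i ∈ Finset.range (m + K), ρ (σ₁ i) := (hτ σ₁ σ₂ _ h₂).1
      _ ≤ C * ((∏ i ∈ Finset.range m, ρ (σ i)) * q ^ K) := by
        rw [Finset.prod_range_add, e]
        gcongr
        exact hq (fun i => σ₁ (m + i)) K
      _ < C * ((∏ i ∈ Finset.range m, ρ (σ i)) * (κ * c / C)) := by gcongr
      _ = κ * (c * ∏ i ∈ Finset.range m, ρ (σ i)) := by field_simp
      _ ≤ κ * r := by gcongr
  obtain ⟨U, hU⟩ := exists_measureReal_eq_sum hP hcyl K fun σ₁ h₁ σ₂ h₂ => by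
    by_contra h
    exact absurd (hsep σ₁ h₁ σ₂ h) (not_le.2 (hclose σ₁ h₁ σ₂ h₂))
  obtain ⟨U', hU'⟩ := exists_measureReal_eq_sum hP (hsub.trans hcyl) K fun σ₁ h₁ σ₂ h₂ => by
    by_contra h
    exact absurd (hsep' σ₁ h₁ σ₂ h) (not_le.2 (hclose σ₁ (hsub h₁) σ₂ h₂))
  have h0 : ∏ i ∈ Finset.range m, p (σ i) ≠ 0 :=
    (Finset.prod_pos fun i _ => (hp _).1).ne'
  exact ⟨(U', U), by simp only [hU, hU', mul_div_mul_left _ _ h0]⟩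

end FiniteTypes

/-! ### Words of nearly maximal density -/

theorem prod_map_pos {n : ℕ} {ρ : Fin n → ℝ} (hρ : ∀ i, 0 < ρ i) (w : List (Fin n)) : 0 < (w.map ρ).prod :=
  List.prod_pos fun x hx => by
    obtain ⟨i, -, rfl⟩ := List.mem_map.1 hx
    exact hρ i

/-- If an additive function `a` on words is dominated by a multiple of the weight
`v ↦ ∏ p`, then along words `w j` that nearly maximise `a / ∏ p` the function `a` becomes
proportional to the weight below `w j`. The deficit `S * ∏ p - a` is nonnegative and additive, so
on every extension of `w j` it is at most its value at `w j`. -/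
theorem exists_extremal_words {n : ℕ} {p : Fin n → ℝ} (hp : ∀ i, 0 < p i) (hsum : ∑ i, p i = 1)
    {a : List (Fin n) → ℝ} (ha : ∀ w, a w = ∑ i, a (w ++ [i])) (hnil : a [] = 1) {M : ℝ}
    (hM : ∀ w, a w ≤ M * (w.map p).prod) :
    ∃ S > 0, ∃ w : ℕ → List (Fin n), ∀ (v : List (Fin n)) (Q : Finset (Fin n)),
      Tendsto (fun j => (∑ b ∈ Q, a (w j ++ v ++ [b])) / ((w j).map p).prod) atTop
        (𝓝 (S * ((v.map p).prod * ∑ b ∈ Q, p b))) := by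
  have hpos := prod_map_pos hp
  have hbdd : BddAbove (range fun w => a w / (w.map p).prod) :=
    ⟨M, by rintro _ ⟨w, rfl⟩; exact (div_le_iff₀ (hpos w)).2 (hM w)⟩
  set S := sSup (range fun w => a w / (w.map p).prod) with hS
  have hle : ∀ w, a w ≤ S * (w.map p).prod := fun w =>
    (div_le_iff₀ (hpos w)).1 (le_csSup hbdd ⟨w, rfl⟩)
  have hS1 : 1 ≤ S := by simpa [hnil] using hle []
  have hd : ∀ w, S * (w.map p).prod - a w
      = ∑ i, (S * ((w ++ [i]).map p).prod - a (w ++ [i])) := fun w => by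
    rw [Finset.sum_sub_distrib, ← ha, ← Finset.mul_sum]
    simp [← Finset.mul_sum, hsum]
  have hd1 : ∀ w i, S * ((w ++ [i]).map p).prod - a (w ++ [i]) ≤ S * (w.map p).prod - a w :=
    fun w i => by
      rw [hd w]
      exact Finset.single_le_sum (f := fun i => S * ((w ++ [i]).map p).prod - a (w ++ [i]))
        (fun j _ => sub_nonneg.2 (hle _)) (Finset.mem_univ i)
  have hd2 : ∀ v w, S * ((w ++ v).map p).prod - a (w ++ v) ≤ S * (w.map p).prod - a w := by
    intro v
    induction v with
    | nil => simp
    | cons i v ih =>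
      intro w
      have := ih (w ++ [i])
      rw [List.append_assoc, List.singleton_append] at this
      exact this.trans (hd1 w i)
  have hex : ∀ j : ℕ, ∃ w, S - 1 / ((j : ℝ) + 1) < a w / (w.map p).prod := fun j => by
    obtain ⟨_, ⟨w, rfl⟩, hw⟩ := exists_lt_of_lt_csSup (range_nonempty _)
      (show S - 1 / ((j : ℝ) + 1) < S from sub_lt_self _ (by positivity))
    exact ⟨w, hw⟩
  choose w hw using hex
  refine ⟨S, by linarith, w, fun v Q => ?_⟩
  have hzero := tendsto_one_div_add_atTop_nhds_zero_nat (𝕜 := ℝ)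
  refine tendsto_of_tendsto_of_tendsto_of_le_of_le
    (g := fun j : ℕ => S * ((v.map p).prod * ∑ b ∈ Q, p b) - 1 / ((j : ℝ) + 1))
    (by simpa using tendsto_const_nhds.sub hzero) tendsto_const_nhds (fun j => ?_) fun j => ?_
  · have h1 : ∑ b ∈ Q, (S * ((w j ++ v ++ [b]).map p).prod - a (w j ++ v ++ [b]))
        ≤ S * ((w j).map p).prod - a (w j) := by
      refine le_trans ?_ (hd2 v (w j))
      rw [hd (w j ++ v)]
      exact Finset.sum_le_univ_sum_of_nonneg fun b => sub_nonneg.2 (hle _)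
    have h2 : ∑ b ∈ Q, S * ((w j ++ v ++ [b]).map p).prod
        = ((w j).map p).prod * (S * ((v.map p).prod * ∑ b ∈ Q, p b)) := by
      simp only [List.map_append, List.prod_append, List.map_cons, List.map_nil, List.prod_singleton,
        Finset.mul_sum]
      exact Finset.sum_congr rfl fun b _ => by ring
    rw [Finset.sum_sub_distrib, h2] at h1
    have h3 := (lt_div_iff₀ (hpos (w j))).1 (hw j)
    dsimp only
    rw [le_div_iff₀ (hpos (w j))]
    linarith
  · rw [div_le_iff₀ (hpos (w j))]
    refine (Finset.sum_le_sum fun b _ => hle _).trans (le_of_eq ?_)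
    simp only [List.map_append, List.prod_append, List.map_cons, List.map_nil, List.prod_singleton,
      Finset.mul_sum, Finset.sum_mul]
    exact Finset.sum_congr rfl fun b _ => by ring

/-! ### Geometry of the touching system -/

section TouchingSystem

variable {n : ℕ} {ρ t : Fin n → ℝ}

/-- The composition `Ψ i₁ ∘ ⋯ ∘ Ψ iₘ` for the word `[i₁, …, iₘ]`. -/
def wordMap (ρ t : Fin n → ℝ) : List (Fin n) → ℝ → ℝ
  | [], x => x
  | i :: w, x => affineIFS ρ t i (wordMap ρ t w x)

theorem wordMap_append (w v : List (Fin n)) (x : ℝ) :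
    wordMap ρ t (w ++ v) x = wordMap ρ t w (wordMap ρ t v x) := by
  induction w with
  | nil => rfl
  | cons i w ih => simp [wordMap, ih]

theorem wordMap_sub (w : List (Fin n)) (x y : ℝ) :
    wordMap ρ t w x - wordMap ρ t w y = (w.map ρ).prod * (x - y) := by
  induction w with
  | nil => simp [wordMap]
  | cons i w ih =>
    simp only [wordMap, affineIFS, List.map_cons, List.prod_cons]
    linear_combination ρ i * ih

theorem wordMap_strictMono (hρ : ∀ i, 0 < ρ i) (w : List (Fin n)) :
    StrictMono (wordMap ρ t w) := fun x y hxy => by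
  have := wordMap_sub (ρ := ρ) (t := t) w y x
  have := mul_pos (prod_map_pos hρ w) (sub_pos.2 hxy)
  linarith

theorem wordMap_surjective (hρ : ∀ i, 0 < ρ i) (w : List (Fin n)) :
    Function.Surjective (wordMap ρ t w) := fun z => by
  refine ⟨(z - wordMap ρ t w 0) / (w.map ρ).prod, ?_⟩
  have h := wordMap_sub (ρ := ρ) (t := t) w ((z - wordMap ρ t w 0) / (w.map ρ).prod) 0
  rw [sub_zero, mul_div_cancel₀ _ (prod_map_pos hρ w).ne'] at h
  linarith

theorem affineIFS_strictMono (hρ : ∀ i, 0 < ρ i) (i : Fin n) : StrictMono (affineIFS ρ t i) :=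
  wordMap_strictMono hρ [i]

theorem wordMap_replicate {i : Fin n} {x : ℝ} (h : affineIFS ρ t i x = x) (k : ℕ) :
    wordMap ρ t (List.replicate k i) x = x := by
  induction k with
  | zero => rfl
  | succ k ih => simp [List.replicate_succ, wordMap, ih, h]

theorem IsTouchingIFS.zero_le (ht : IsTouchingIFS ρ t) (hρ : ∀ i, 0 < ρ i) (i : Fin n) :
    0 ≤ affineIFS ρ t i 0 := by
  have hi := i.2
  have h0 := ht.left_end ⟨0, by omega⟩ rfl
  rcases Nat.eq_zero_or_pos (i : ℕ) with h | h
  · rw [ht.left_end i h]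
  · have := ht.ordered ⟨0, by omega⟩ i h
    have := (affineIFS_strictMono (t := t) hρ ⟨0, by omega⟩) one_pos
    linarith

theorem IsTouchingIFS.le_one (ht : IsTouchingIFS ρ t) (hρ : ∀ i, 0 < ρ i) (i : Fin n) :
    affineIFS ρ t i 1 ≤ 1 := by
  have hi := i.2
  have h1 := ht.right_end ⟨n - 1, by omega⟩ (by simp; omega)
  by_cases h : (i : ℕ) + 1 = n
  · rw [ht.right_end i h]
  · have := ht.ordered i ⟨n - 1, by omega⟩ (Fin.lt_def.2 (by simp; omega))
    have := (affineIFS_strictMono (t := t) hρ ⟨n - 1, by omega⟩) one_pos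
    linarith

theorem IsTouchingIFS.wordMap_zero_nonneg (ht : IsTouchingIFS ρ t) (hρ : ∀ i, 0 < ρ i)
    (w : List (Fin n)) : 0 ≤ wordMap ρ t w 0 := by
  induction w with
  | nil => exact le_rfl
  | cons i w ih => exact (ht.zero_le hρ i).trans ((affineIFS_strictMono hρ i).monotone ih)

theorem IsTouchingIFS.wordMap_one_le (ht : IsTouchingIFS ρ t) (hρ : ∀ i, 0 < ρ i)
    (w : List (Fin n)) : wordMap ρ t w 1 ≤ 1 := by
  induction w with
  | nil => exact le_rfl
  | cons i w ih => exact ((affineIFS_strictMono hρ i).monotone ih).trans (ht.le_one hρ i)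

theorem IsTouchingIFS.attractor_subset (ht : IsTouchingIFS ρ t) (hρ : ∀ i, 0 < ρ i ∧ ρ i < 1)
    {T : Set ℝ} (hT : IsAttractor (affineIFS ρ t) T) : T ⊆ Icc 0 1 := by
  obtain ⟨hne, hc, hU⟩ := hT
  have hρ' := fun i => (hρ i).1
  have hmax := hc.sSup_mem hne
  have hmin := hc.sInf_mem hne
  have h1 : sSup T ≤ 1 := by
    have h := hmax
    rw [← hU] at h
    obtain ⟨i, y, hy, e⟩ := mem_iUnion.1 h
    have hy' := le_csSup hc.bddAbove hy
    rw [hU] at e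
    have := ht.le_one hρ' i
    simp only [affineIFS] at e this
    nlinarith [hρ i, mul_le_mul_of_nonneg_left hy' (hρ' i).le]
  have h0 : 0 ≤ sInf T := by
    have h := hmin
    rw [← hU] at h
    obtain ⟨i, y, hy, e⟩ := mem_iUnion.1 h
    have hy' := csInf_le hc.bddBelow hy
    rw [hU] at e
    have := ht.zero_le hρ' i
    simp only [affineIFS] at e this
    nlinarith [hρ i, mul_le_mul_of_nonneg_left hy' (hρ' i).le]
  exact fun x hx => ⟨h0.trans (csInf_le hc.bddBelow hx), (le_csSup hc.bddAbove hx).trans h1⟩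

/-- Inside the open interval `Ψ_w (0,1)` the attractor is the copy `Ψ_w (T)`. -/
theorem IsTouchingIFS.mem_of_wordMap_mem (ht : IsTouchingIFS ρ t)
    (hρ : ∀ i, 0 < ρ i ∧ ρ i < 1) {T : Set ℝ} (hT : IsAttractor (affineIFS ρ t) T)
    {w : List (Fin n)} {x : ℝ} (hx : x ∈ Ioo (0 : ℝ) 1) (h : wordMap ρ t w x ∈ T) : x ∈ T := by
  have hρ' := fun i => (hρ i).1
  induction w with
  | nil => exact h
  | cons i w ih =>
    refine ih ?_
    simp only [wordMap] at h
    set y := wordMap ρ t w x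
    have hy0 : 0 < y := (ht.wordMap_zero_nonneg hρ' w).trans_lt (wordMap_strictMono hρ' w hx.1)
    have hy1 : y < 1 := (wordMap_strictMono hρ' w hx.2).trans_le (ht.wordMap_one_le hρ' w)
    have h' := h
    rw [← hT.2.2] at h'
    obtain ⟨j, z, hz, e⟩ := mem_iUnion.1 h'
    have hz01 := ht.attractor_subset hρ hT hz
    have m0 := affineIFS_strictMono (t := t) hρ' i hy0
    have m1 := affineIFS_strictMono (t := t) hρ' i hy1
    have z0 := (affineIFS_strictMono (t := t) hρ' j).monotone hz01.1
    have z1 := (affineIFS_strictMono (t := t) hρ' j).monotone hz01.2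
    rcases lt_trichotomy i j with hij | rfl | hij
    · linarith [ht.ordered i j hij]
    · rwa [← (affineIFS_strictMono (t := t) hρ' i).injective e]
    · linarith [ht.ordered j i hij]

/-- Gaps of the attractor are mapped to gaps. -/
theorem IsTouchingIFS.wordMap_gap (ht : IsTouchingIFS ρ t)
    (hρ : ∀ i, 0 < ρ i ∧ ρ i < 1) {T : Set ℝ} (hT : IsAttractor (affineIFS ρ t) T)
    {x y : ℝ} (hx : 0 ≤ x) (hy : y ≤ 1) (h : Disjoint T (Ioo x y)) (w : List (Fin n)) :
    Disjoint T (Ioo (wordMap ρ t w x) (wordMap ρ t w y)) := by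
  have hρ' := fun i => (hρ i).1
  refine Set.disjoint_left.2 fun z hz hz' => ?_
  obtain ⟨u, rfl⟩ := wordMap_surjective (t := t) hρ' w z
  have h1 := (wordMap_strictMono hρ' w).lt_iff_lt.1 hz'.1
  have h2 := (wordMap_strictMono hρ' w).lt_iff_lt.1 hz'.2
  exact Set.disjoint_left.1 h
    (ht.mem_of_wordMap_mem hρ hT ⟨hx.trans_lt h1, h2.trans_le hy⟩ hz) ⟨h1, h2⟩

/-- As `∑ ρ i < 1`, the intervals `Ψ i [0,1]` cannot all touch. -/
theorem IsTouchingIFS.exists_gap (ht : IsTouchingIFS ρ t) (hn : 0 < n) (hsum : ∑ i, ρ i < 1) :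
    ∃ a b : Fin n, (b : ℕ) = a + 1 ∧ affineIFS ρ t a 1 < affineIFS ρ t b 0 := by
  by_contra! h
  let g : ℕ → ℝ := fun m => if hm : m < n then t ⟨m, hm⟩ else 1
  have hg : ∀ i : Fin n, ρ i = g (i + 1) - g i := fun i => by
    by_cases hi : (i : ℕ) + 1 < n
    · have h1 := ht.ordered i ⟨i + 1, hi⟩ (Fin.lt_def.2 (by simp))
      have h2 := h i ⟨i + 1, hi⟩ rfl
      simp only [affineIFS] at h1 h2
      simp only [g, hi, i.2, dif_pos]
      linarith
    · have := ht.right_end i (by omega)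
      simp only [affineIFS] at this
      simp only [g, hi, i.2, dif_pos, dif_neg, not_false_eq_true]
      linarith
  have h0 := ht.left_end ⟨0, hn⟩ rfl
  rw [Finset.sum_congr rfl fun i _ => hg i,
    Fin.sum_univ_eq_sum_range (fun m => g (m + 1) - g m), Finset.sum_range_sub] at hsum
  simp [affineIFS, g, hn] at h0 hsum
  linarith

/-- For a measure carried by the attractor and without atoms, the mass of `Ψ_w [x, x']` is the sum
of the masses of the intervals `Ψ_w Ψ_b [0,1]` that it contains, provided that it avoids the other
ones. -/
theorem IsTouchingIFS.measureReal_wordMap_Icc (ht : IsTouchingIFS ρ t)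
    (hρ : ∀ i, 0 < ρ i ∧ ρ i < 1) {T : Set ℝ} (hT : IsAttractor (affineIFS ρ t) T)
    {ν : Measure ℝ} [IsProbabilityMeasure ν] [NullSingletonClass ν] (hν : ν Tᶜ = 0)
    {x x' : ℝ} (hx : 0 ≤ x) (hx' : x' ≤ 1) {Q : Finset (Fin n)}
    (hin : ∀ b ∈ Q, x ≤ affineIFS ρ t b 0 ∧ affineIFS ρ t b 1 ≤ x')
    (hout : ∀ b ∉ Q, affineIFS ρ t b 1 < x ∨ x' < affineIFS ρ t b 0) (w : List (Fin n)) :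
    ν.real (Icc (wordMap ρ t w x) (wordMap ρ t w x'))
      = ∑ b ∈ Q, ν.real (Icc (wordMap ρ t (w ++ [b]) 0) (wordMap ρ t (w ++ [b]) 1)) := by
  have hρ' := fun i => (hρ i).1
  have hmono := wordMap_strictMono (t := t) hρ' w
  have hlast : ∀ b x, wordMap ρ t (w ++ [b]) x = wordMap ρ t w (affineIFS ρ t b x) :=
    fun b x => wordMap_append w [b] x
  have hIoo : ∀ b, ν.real (Icc (wordMap ρ t (w ++ [b]) 0) (wordMap ρ t (w ++ [b]) 1))
      = ν.real (Ioo (wordMap ρ t (w ++ [b]) 0) (wordMap ρ t (w ++ [b]) 1)) := fun b =>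
    (measureReal_congr Ioo_ae_eq_Icc).symm
  have hdisj : (Q : Set (Fin n)).PairwiseDisjoint
      fun b => Ioo (wordMap ρ t (w ++ [b]) 0) (wordMap ρ t (w ++ [b]) 1) := by
    have : ∀ b b' : Fin n, b < b' →
        Disjoint (Ioo (wordMap ρ t (w ++ [b]) 0) (wordMap ρ t (w ++ [b]) 1))
          (Ioo (wordMap ρ t (w ++ [b']) 0) (wordMap ρ t (w ++ [b']) 1)) := fun b b' hb => by
      refine Set.disjoint_left.2 fun z hz hz' => ?_
      have := hmono.monotone (ht.ordered b b' hb)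
      rw [← hlast, ← hlast] at this
      linarith [hz.2, hz'.1]
    intro b _ b' _ hne
    rcases lt_or_gt_of_ne hne with h | h
    exacts [this b b' h, (this b' b h).symm]
  rw [Finset.sum_congr rfl fun b _ => hIoo b,
    ← measureReal_biUnion_finset hdisj fun b _ => measurableSet_Ioo]
  apply le_antisymm
  · set N : Set ℝ := Tᶜ ∪ ({wordMap ρ t w 0, wordMap ρ t w 1} ∪
      ((range fun b => wordMap ρ t (w ++ [b]) 0) ∪ range fun b => wordMap ρ t (w ++ [b]) 1)) with hN
    have hN0 : ν.real N = 0 := by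
      rw [measureReal_def, ENNReal.toReal_eq_zero_iff]
      left
      refine measure_union_null hν (Set.Finite.measure_zero ?_ _)
      exact (Set.toFinite _).union ((finite_range _).union (finite_range _))
    have hsub : Icc (wordMap ρ t w x) (wordMap ρ t w x') ⊆
        (⋃ b ∈ Q, Ioo (wordMap ρ t (w ++ [b]) 0) (wordMap ρ t (w ++ [b]) 1)) ∪ N := by
      intro z hz
      by_cases hzN : z ∈ N
      · exact Or.inr hzN
      left
      simp only [hN, mem_union, mem_compl_iff, mem_insert_iff, mem_singleton_iff, mem_range,
        not_or, not_not, not_exists] at hzN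
      obtain ⟨hzT, ⟨hz0, hz1⟩, hzb0, hzb1⟩ := hzN
      obtain ⟨u, rfl⟩ := wordMap_surjective (t := t) hρ' w z
      have hu1 := hmono.le_iff_le.1 hz.1
      have hu2 := hmono.le_iff_le.1 hz.2
      have hu : u ∈ Ioo (0 : ℝ) 1 :=
        ⟨lt_of_le_of_ne (hx.trans hu1) fun e => hz0 (by rw [e]),
          lt_of_le_of_ne (hu2.trans hx') fun e => hz1 (by rw [e])⟩
      have huT := ht.mem_of_wordMap_mem hρ hT hu hzT
      rw [← hT.2.2] at huT
      obtain ⟨b, y, hy, rfl⟩ := mem_iUnion.1 huT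
      have hy01 := ht.attractor_subset hρ hT hy
      have hb0 := (affineIFS_strictMono (t := t) hρ' b).monotone hy01.1
      have hb1 := (affineIFS_strictMono (t := t) hρ' b).monotone hy01.2
      have hbQ : b ∈ Q := by
        by_contra hb
        rcases hout b hb with h | h <;> linarith
      refine mem_biUnion hbQ ⟨?_, ?_⟩
      · exact lt_of_le_of_ne (by rw [hlast]; exact hmono.monotone hb0) (hzb0 b)
      · exact lt_of_le_of_ne (by rw [hlast]; exact hmono.monotone hb1) fun e => hzb1 b e.symm
    calc _ ≤ _ := measureReal_mono hsub
      _ ≤ _ := measureReal_union_le _ _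
      _ = _ := by rw [hN0, add_zero]
  · refine measureReal_mono (iUnion₂_subset fun b hb => ?_)
    rw [hlast, hlast]
    exact Ioo_subset_Icc_self.trans
      (Icc_subset_Icc (hmono.monotone (hin b hb).1) (hmono.monotone (hin b hb).2))

end TouchingSystem

/-! ### The measure transported to the touching set -/

theorem exists_similarity_dimension {n : ℕ} (hn : 2 ≤ n) {ρ : Fin n → ℝ}
    (hρ : IsContractionVector ρ) : ∃ s : ℝ, 0 < s ∧ ∑ i, ρ i ^ s = 1 := by
  have hcont : Continuous fun s : ℝ => ∑ i, ρ i ^ s :=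
    continuous_finsetSum _ fun i _ => Real.continuous_const_rpow (hρ.1 i).1.ne'
  have hn' : (2 : ℝ) ≤ n := by exact_mod_cast hn
  obtain ⟨s, hs, hs1⟩ := intermediate_value_Icc' zero_le_one hcont.continuousOn
    (show (1 : ℝ) ∈ Icc (∑ i, ρ i ^ (1 : ℝ)) (∑ i, ρ i ^ (0 : ℝ)) by
      simp only [Real.rpow_one, Real.rpow_zero, Finset.sum_const, Finset.card_univ,
        Fintype.card_fin, nsmul_eq_mul, mul_one]
      exact ⟨hρ.2.le, by linarith⟩)
  refine ⟨s, lt_of_le_of_ne hs.1 fun h => ?_, hs1⟩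
  simp only [← h, Real.rpow_zero, Finset.sum_const, Finset.card_univ, Fintype.card_fin,
    nsmul_eq_mul, mul_one] at hs1
  linarith

theorem prod_map_rpow {n : ℕ} {ρ : Fin n → ℝ} (hρ : ∀ i, 0 < ρ i) (s : ℝ) (w : List (Fin n)) :
    (w.map fun i => ρ i ^ s).prod = (w.map ρ).prod ^ s := by
  induction w with
  | nil => simp
  | cons i w ih =>
    simp only [List.map_cons, List.prod_cons, ih]
    rw [Real.mul_rpow (hρ i).le (prod_map_pos hρ w).le]

/-- The Bernoulli measure of exponent `s` on `D`, transported to `T`, is an atomless measure whose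
mass on a set is at most a multiple of the `s`-th power of the diameter, and which takes, up to
scaling, finitely many values on well separated pieces of `T`. -/
theorem exists_transported_measure {n : ℕ} {ρ : Fin n → ℝ} {D T : Set ℝ} {s : ℝ}
    (hρ01 : ∀ i, 0 < ρ i ∧ ρ i < 1) (hs : 0 < s) (hsum : ∑ i, ρ i ^ s = 1)
    (hD : D ∈ dustLikeFamily ρ) (hDT : LipschitzEquivalent D T) (hTm : MeasurableSet T) :
    ∃ ν : Measure ℝ, IsProbabilityMeasure ν ∧ NullSingletonClass ν ∧ ν Tᶜ = 0 ∧
      (∃ M, 0 ≤ M ∧ ∀ (B : Set ℝ) (r : ℝ), MeasurableSet B → 0 ≤ r →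
        (∀ x ∈ B, ∀ y ∈ B, |x - y| ≤ r) → ν.real B ≤ M * r ^ s) ∧
      ∀ κ > 0, ∃ Γ : Set ℝ, Γ.Finite ∧ ∀ (r : ℝ) (B B' : Set ℝ), 0 < r →
        MeasurableSet B → MeasurableSet B' → B' ⊆ B → (∀ x ∈ B, ∀ y ∈ B, |x - y| ≤ r) →
        (∀ x ∈ B, ∀ z ∈ T, z ∉ B → κ * r ≤ |x - z|) →
        (∀ x ∈ B', ∀ z ∈ T, z ∉ B' → κ * r ≤ |x - z|) →
        0 < ν.real B → ν.real B' / ν.real B ∈ Γ := by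
  have hρ' := fun i => (hρ01 i).1
  set p : Fin n → ℝ := fun i => ρ i ^ s with hp
  have hp01 : ∀ i, 0 < p i ∧ p i < 1 := fun i =>
    ⟨Real.rpow_pos_of_pos (hρ' i) s, Real.rpow_lt_one (hρ' i).le (hρ01 i).2 hs⟩
  obtain ⟨τ, c, C, hc, hC, hτT, hτ⟩ := exists_bilipschitzCoding hρ' hD hDT
  obtain ⟨P, hPprob, hP⟩ := exists_bernoulli (fun i => (hp01 i).1) hsum
  have hτm : Measurable τ := (hτ.continuous hρ01 hC).measurable
  set ν := P.map τ with hν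
  have : IsProbabilityMeasure ν := Measure.isProbabilityMeasure_map hτm.aemeasurable
  have hνapp : ∀ {B : Set ℝ}, MeasurableSet B → ν.real B = P.real (τ ⁻¹' B) := fun hB =>
    map_measureReal_apply hτm hB
  have hνT : ν Tᶜ = 0 := by
    rw [hν, Measure.map_apply hτm hTm.compl,
      show τ ⁻¹' Tᶜ = ∅ from eq_empty_of_forall_notMem fun σ h => h (hτT σ), measure_empty]
  have hνmass : ∀ {B : Set ℝ} {r : ℝ}, MeasurableSet B → (∀ x ∈ B, ∀ y ∈ B, |x - y| ≤ r) →
      0 < ν.real B → 0 < r ∧ ν.real B ≤ (r / c) ^ s := by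
    intro B r hB hr hpos
    rw [hνapp hB] at hpos ⊢
    obtain ⟨σ, m, hcyl, hm⟩ := hτ.exists_cylinder hp01 hP hpos fun σ h σ' h' => hr _ h _ h'
    have h0 : 0 < ∏ i ∈ Finset.range m, ρ (σ i) := Finset.prod_pos fun i _ => hρ' _
    refine ⟨(mul_pos hc h0).trans_le hm, ?_⟩
    calc _ ≤ _ := measureReal_mono hcyl
      _ = (∏ i ∈ Finset.range m, ρ (σ i)) ^ s := by
        rw [hP, Real.finsetProd_rpow _ _ fun i _ => (hρ' _).le]
      _ ≤ _ := Real.rpow_le_rpow h0.le ((le_div_iff₀' hc).2 hm) hs.le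
  have : NullSingletonClass ν := ⟨fun x => by
    by_contra h
    have hpos : 0 < ν.real {x} := ENNReal.toReal_pos h (measure_ne_top _ _)
    refine (hνmass (r := 0) (measurableSet_singleton x) ?_ hpos).1.false
    rintro _ rfl _ rfl
    simp⟩
  refine ⟨ν, inferInstance, inferInstance, hνT, ⟨(1 / c) ^ s, by positivity, ?_⟩, ?_⟩
  · intro B r hB hr hBr
    rcases (measureReal_nonneg (μ := ν) (s := B)).eq_or_lt with h | h
    · rw [← h]; positivity
    · rw [← Real.mul_rpow (by positivity) hr, one_div_mul_eq_div]
      exact (hνmass hB hBr h).2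
  · intro κ hκ
    obtain ⟨Γ, hΓ, hratio⟩ := hτ.exists_finite_ratios hc hC hρ01 hp01 hP hκ
    refine ⟨Γ, hΓ, fun r B B' hr hB hB' hsub hdiam hsep hsep' hpos => ?_⟩
    rw [hνapp hB] at hpos
    rw [hνapp hB, hνapp hB']
    exact hratio r _ _ hr (preimage_mono hsub) (fun σ h σ' h' => hdiam _ h _ h')
      (fun σ h σ' h' => hsep _ h _ (hτT σ') h') (fun σ h σ' h' => hsep' _ h _ (hτT σ') h') hpos

/-! ### Pieces around a touching point -/

/-- A piece of `T` between two gaps is separated from the rest of `T` by the lengths of the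
gaps. -/
theorem le_abs_sub_of_gaps {T : Set ℝ} {u' u v v' x z η : ℝ} (hu : Disjoint T (Ioo u' u))
    (hv : Disjoint T (Ioo v v')) (hηu : η ≤ u - u') (hηv : η ≤ v' - v) (hx : x ∈ Icc u v)
    (hz : z ∈ T) (hz' : z ∉ Icc u v) : η ≤ |x - z| := by
  rcases lt_or_ge z u with h | h
  · have : z ≤ u' := not_lt.1 fun h' => Set.disjoint_left.1 hu hz ⟨h', h⟩
    exact le_trans (by linarith [hx.1]) (le_abs_self _)
  · have h1 : v < z := not_le.1 fun h' => hz' ⟨h, h'⟩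
    have : v' ≤ z := not_lt.1 fun h' => Set.disjoint_left.1 hv hz ⟨h1, h'⟩
    rw [abs_sub_comm]
    exact le_trans (by linarith [hx.2]) (le_abs_self _)

/-- A value taken twice by the relative masses of the pieces around a touching point forces a
multiplicative relation between the outer ratios. -/
theorem mul_eq_mul_of_ratio_eq {A B q x x' y y' : ℝ} (hA : 0 < A) (hB : 0 < B) (hq : q ≠ 1)
    (hx : 0 < x) (hx' : 0 < x') (hy : 0 < y) (hy' : 0 < y')
    (h : (A * (x * q) + B * y) / (A * x + B * y) = (A * (x' * q) + B * y') / (A * x' + B * y')) :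
    x * y' = x' * y := by
  rw [div_eq_div_iff (by positivity) (by positivity)] at h
  have h1 : (A * B * (q - 1)) * (x * y' - x' * y) = 0 := by linear_combination h
  have h2 : A * B * (q - 1) ≠ 0 := mul_ne_zero (mul_pos hA hB).ne' (sub_ne_zero.2 hq)
  linarith [(mul_eq_zero.1 h1).resolve_left h2]

theorem exists_rat_log_div_log {x y : ℝ} (hx : 0 < x) (hy0 : 0 < y) (hy1 : y < 1) {k k' l l' : ℕ}
    (hk : k ≠ k') (h : y ^ k * x ^ l' = y ^ k' * x ^ l) :
    ∃ q : ℚ, Real.log x / Real.log y = q := by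
  have hy := (Real.log_neg hy0 hy1).ne
  have h1 := congrArg Real.log h
  rw [Real.log_mul (by positivity) (by positivity), Real.log_mul (by positivity) (by positivity),
    Real.log_pow, Real.log_pow, Real.log_pow, Real.log_pow] at h1
  have hkk : (k : ℝ) - k' ≠ 0 := sub_ne_zero.2 (by exact_mod_cast hk)
  have h2 : ((l : ℝ) - l') * Real.log x = (k - k') * Real.log y := by linear_combination -h1
  have hll : (l : ℝ) - l' ≠ 0 := fun h0 => by
    rw [h0, zero_mul] at h2
    exact mul_ne_zero hkk hy h2.symm
  refine ⟨((k : ℚ) - k') / (l - l'), ?_⟩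
  push_cast
  rw [div_eq_div_iff hy hll]
  linear_combination h2

theorem theorem1p1 (n : ℕ) (hn : 3 ≤ n) (ρ t : Fin n → ℝ) (D T : Set ℝ)
    (hρ : IsContractionVector ρ)
    (hD : D ∈ dustLikeFamily ρ)
    (ht : IsTouchingIFS ρ t)
    (hT : IsAttractor (affineIFS ρ t) T)
    (hDT : LipschitzEquivalent D T) :
    ∃ q : ℚ, Real.log (ρ ⟨0, by omega⟩) / Real.log (ρ ⟨n - 1, by omega⟩) = (q : ℝ) := by
  have hρ01 := hρ.1
  have hρ' := fun i => (hρ01 i).1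
  obtain ⟨s, hs, hsum⟩ := exists_similarity_dimension (by omega) hρ
  set p : Fin n → ℝ := fun i => ρ i ^ s with hp
  have hp01 : ∀ i, 0 < p i ∧ p i < 1 := fun i =>
    ⟨Real.rpow_pos_of_pos (hρ' i) s, Real.rpow_lt_one (hρ' i).le (hρ01 i).2 hs⟩
  have hp' := fun i => (hp01 i).1
  have hTm := hT.2.1.isClosed.measurableSet
  obtain ⟨ν, _, _, hνT, ⟨M, hM0, hM⟩, hfin⟩ :=
    exists_transported_measure hρ01 hs hsum hD hDT hTm
  -- The masses of the intervals `Ψ_w [0,1]` and the words along which they are nearly maximal.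
  obtain ⟨S, hS, W, hW⟩ := exists_extremal_words (p := p) hp' hsum
    (a := fun w => ν.real (Icc (wordMap ρ t w 0) (wordMap ρ t w 1))) (M := M)
    (fun w => ht.measureReal_wordMap_Icc hρ01 hT hνT le_rfl le_rfl
      (fun b _ => ⟨ht.zero_le hρ' b, ht.le_one hρ' b⟩)
      (fun b hb => absurd (Finset.mem_univ b) hb) w)
    (by
      simp only [wordMap]
      have h1 : ν.real T = 1 := by
        have := measureReal_compl (μ := ν) hTm
        rw [measureReal_def, hνT] at this
        simp at this
        linarith
      exact le_antisymm measureReal_le_one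
        (h1.symm.le.trans (measureReal_mono (ht.attractor_subset hρ01 hT))))
    (fun w => by
      have hw := prod_map_pos hρ' w
      rw [prod_map_rpow hρ']
      refine hM _ _ measurableSet_Icc hw.le fun x hx y hy => ?_
      have := wordMap_sub (ρ := ρ) (t := t) w 1 0
      rw [abs_le]
      constructor <;> linarith [hx.1, hx.2, hy.1, hy.2])
  obtain ⟨a, b, hab, hgap⟩ := ht.exists_gap (by omega) hρ.2
  obtain ⟨i, j, -, hij⟩ := ht.touching
  set f : Fin n := ⟨0, by omega⟩ with hf
  set e : Fin n := ⟨n - 1, by omega⟩ with he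
  have hf0 : affineIFS ρ t f 0 = 0 := ht.left_end f rfl
  have he1 : affineIFS ρ t e 1 = 1 := ht.right_end e (by simp only [he]; omega)
  set y' := affineIFS ρ t a 1 with hy'
  set y := affineIFS ρ t b 0 with hy
  have hy'0 : 0 < y' := (ht.zero_le hρ' a).trans_lt (affineIFS_strictMono hρ' a one_pos)
  have hy1 : y < 1 := (affineIFS_strictMono hρ' b one_pos).trans_le (ht.le_one hρ' b)
  have hright : ∀ d : Fin n, a < d → y ≤ affineIFS ρ t d 0 := fun d hd => by
    rcases eq_or_lt_of_le (show b ≤ d from Fin.le_def.2 (by rw [Fin.lt_def] at hd; omega)) with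
      rfl | h
    · exact le_rfl
    · exact (affineIFS_strictMono hρ' b one_pos).le.trans (ht.ordered b d h)
  have hleft : ∀ d : Fin n, d ≤ a → affineIFS ρ t d 1 ≤ y' := fun d hd => by
    rcases eq_or_lt_of_le hd with rfl | h
    · exact le_rfl
    · exact (ht.ordered d a h).trans (affineIFS_strictMono hρ' a one_pos).le
  have hTgap : Disjoint T (Ioo y' y) := by
    refine Set.disjoint_left.2 fun z hz hz' => ?_
    rw [← hT.2.2] at hz
    obtain ⟨d, x, hx, rfl⟩ := mem_iUnion.1 hz
    have hx01 := ht.attractor_subset hρ01 hT hx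
    have h0 := (affineIFS_strictMono (t := t) hρ' d).monotone hx01.1
    have h1 := (affineIFS_strictMono (t := t) hρ' d).monotone hx01.2
    rcases lt_or_ge a d with h | h
    · linarith [hright d h, hz'.2]
    · linarith [hleft d h, hz'.1]
  -- The pieces `[Ψ_w Ψ_i Ψ_e^k y, Ψ_w Ψ_j Ψ_f^l y']` of `T` around the touching point of `Ψ_w (T)`.
  let L : List (Fin n) → ℕ → List (Fin n) := fun w k => w ++ i :: List.replicate k e
  let R : List (Fin n) → ℕ → List (Fin n) := fun w l => w ++ j :: List.replicate l f
  let piece : List (Fin n) → ℕ → ℕ → Set ℝ := fun w k l =>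
    Icc (wordMap ρ t (L w k) y) (wordMap ρ t (R w l) y')
  have hmid : ∀ w k l, wordMap ρ t (L w k) 1 = wordMap ρ t (R w l) 0 := fun w k l => by
    simp only [L, R, wordMap_append, wordMap, wordMap_replicate he1, wordMap_replicate hf0, hij]
  have hLprod : ∀ (q : Fin n → ℝ) w k, ((L w k).map q).prod = (w.map q).prod * (q i * q e ^ k) :=
    fun q w k => by simp [L]
  have hRprod : ∀ (q : Fin n → ℝ) w l, ((R w l).map q).prod = (w.map q).prod * (q j * q f ^ l) :=
    fun q w l => by simp [R]
  set α := ∑ d ∈ Finset.univ.filter (a < ·), p d with hα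
  set β := ∑ d ∈ Finset.univ.filter (· ≤ a), p d with hβ
  have hα0 : 0 < α := Finset.sum_pos (fun d _ => hp' d)
    ⟨b, Finset.mem_filter.2 ⟨Finset.mem_univ _, Fin.lt_def.2 (by omega)⟩⟩
  have hβ0 : 0 < β := Finset.sum_pos (fun d _ => hp' d)
    ⟨a, Finset.mem_filter.2 ⟨Finset.mem_univ _, le_rfl⟩⟩
  have hmass : ∀ k l, Tendsto (fun m => ν.real (piece (W m) k l) / ((W m).map p).prod) atTop
      (𝓝 (S * (p i * α * p e ^ k + p j * β * p f ^ l))) := fun k l => by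
    have h1 := hW (i :: List.replicate k e) (Finset.univ.filter (a < ·))
    have h2 := hW (j :: List.replicate l f) (Finset.univ.filter (· ≤ a))
    convert h1.add h2 using 2 with m
    · have hU : wordMap ρ t (L (W m) k) y ≤ wordMap ρ t (L (W m) k) 1 :=
        (wordMap_strictMono hρ' _).monotone hy1.le
      have hV : wordMap ρ t (R (W m) l) 0 ≤ wordMap ρ t (R (W m) l) y' :=
        (wordMap_strictMono hρ' _).monotone hy'0.le
      have hsplit : ν.real (piece (W m) k l)
          = ν.real (Icc (wordMap ρ t (L (W m) k) y) (wordMap ρ t (L (W m) k) 1))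
            + ν.real (Icc (wordMap ρ t (R (W m) l) 0) (wordMap ρ t (R (W m) l) y')) := by
        rw [hmid _ k l] at hU ⊢
        rw [← measureReal_congr (μ := ν) (Ioc_ae_eq_Icc (a := wordMap ρ t (R (W m) l) 0)),
          ← measureReal_union (Set.disjoint_left.2 fun z hz hz' => not_lt.2 hz.2 hz'.1)
            measurableSet_Ioc, Icc_union_Ioc_eq_Icc hU hV]
      rw [hsplit, add_div]
      congr 2
      · refine ht.measureReal_wordMap_Icc hρ01 hT hνT (hy'0.trans hgap).le le_rfl
          (fun d hd => ⟨hright d (Finset.mem_filter.1 hd).2, ht.le_one hρ' d⟩)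
          (fun d hd => Or.inl ?_) _
        exact (hleft d (not_lt.1 fun h => hd (Finset.mem_filter.2 ⟨Finset.mem_univ _, h⟩))).trans_lt
          hgap
      · refine ht.measureReal_wordMap_Icc hρ01 hT hνT le_rfl (hgap.trans hy1).le
          (fun d hd => ⟨ht.zero_le hρ' d, hleft d (Finset.mem_filter.1 hd).2⟩)
          (fun d hd => Or.inr ?_) _
        exact hgap.trans_le
          (hright d (not_le.1 fun h => hd (Finset.mem_filter.2 ⟨Finset.mem_univ _, h⟩)))
    · simp only [List.map_cons, List.prod_cons, List.map_replicate, List.prod_replicate]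
      rw [hα, hβ]
      ring
  have hsep : ∀ w k l η, η ≤ (w.map ρ).prod * (ρ i * ρ e ^ k) * (y - y') →
      η ≤ (w.map ρ).prod * (ρ j * ρ f ^ l) * (y - y') →
      ∀ x ∈ piece w k l, ∀ z ∈ T, z ∉ piece w k l → η ≤ |x - z| := by
    intro w k l η h1 h2 x hx z hz hz'
    have g := fun v => ht.wordMap_gap hρ01 hT hy'0.le hy1.le hTgap v
    refine le_abs_sub_of_gaps (g (L w k)) (g (R w l)) ?_ ?_ hx hz hz'
    · rwa [wordMap_sub, hLprod]
    · rwa [wordMap_sub, hRprod]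
  -- For each `k` the right side of the piece is chosen comparable to the left side.
  have hl : ∀ k : ℕ, ∃ l : ℕ, ρ f ^ (l + 1) < ρ e ^ k ∧ ρ e ^ k ≤ ρ f ^ l := fun k =>
    exists_nat_pow_near_of_lt_one (pow_pos (hρ' e) k)
      (pow_le_one₀ (hρ' e).le (hρ01 e).2.le) (hρ' f) (hρ01 f).2
  choose l hl1 hl2 using hl
  -- The pieces for `(k, l k)` have diameter at most `ρ_w * ρ e ^ k * Λ`.
  set Λ := 1 + 1 / ρ f with hΛ
  have hΛ0 : 0 < Λ := by have := hρ' f; positivity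
  have hyy : 0 < y - y' := sub_pos.2 hgap
  obtain ⟨Γ, hΓ, hratio⟩ := hfin
    ((y - y') * (ρ i * ρ j * ρ e) / Λ) (by
      have := hρ' i; have := hρ' j; have := hρ' e; positivity)
  have hmem : ∀ k, (p i * α * (p e ^ k * p e) + p j * β * p f ^ l k)
      / (p i * α * p e ^ k + p j * β * p f ^ l k) ∈ Γ := by
    intro k
    have hpos : 0 < p i * α * p e ^ k + p j * β * p f ^ l k := by
      have := hp' i; have := hp' j; have := hp' e; have := hp' f; positivity
    have hlim := (hmass (k + 1) (l k)).div (hmass k (l k)) (mul_pos hS hpos).ne'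
    rw [mul_div_mul_left _ _ hS.ne', pow_succ] at hlim
    refine hΓ.isClosed.mem_of_tendsto hlim ?_
    filter_upwards [(hmass k (l k)).eventually (lt_mem_nhds (mul_pos hS hpos))] with m hm
    have hpW := prod_map_pos hp' (W m)
    have hw := prod_map_pos hρ' (W m)
    simp only [Pi.div_apply]
    rw [div_div_div_cancel_right₀ hpW.ne']
    have hνpos : 0 < ν.real (piece (W m) k (l k)) := by
      by_contra h
      exact absurd hm (not_lt.2 (div_nonpos_of_nonpos_of_nonneg (not_lt.1 h) hpW.le))
    have hik := hρ' i; have hjk := hρ' j; have hek := hρ' e; have hfk := hρ' f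
    have hekk : 0 < ρ e ^ k := pow_pos hek k
    have hκ : (y - y') * (ρ i * ρ j * ρ e) / Λ * (((W m).map ρ).prod * ρ e ^ k * Λ)
        = ((W m).map ρ).prod * (ρ i * ρ j * (ρ e ^ k * ρ e)) * (y - y') := by
      field_simp
    have hk1 : ρ e ^ k * ρ e ≤ ρ e ^ k := mul_le_of_le_one_right hekk.le (hρ01 e).2.le
    have hκL : ((W m).map ρ).prod * (ρ i * ρ j * (ρ e ^ k * ρ e)) * (y - y')
        ≤ ((W m).map ρ).prod * (ρ i * (ρ e ^ k * ρ e)) * (y - y') := by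
      gcongr
      exact mul_le_of_le_one_right hik.le (hρ01 j).2.le
    have hκR : ((W m).map ρ).prod * (ρ i * ρ j * (ρ e ^ k * ρ e)) * (y - y')
        ≤ ((W m).map ρ).prod * (ρ j * ρ f ^ l k) * (y - y') := by
      gcongr
      · exact mul_le_of_le_one_left hjk.le (hρ01 i).2.le
      · exact hk1.trans (hl2 k)
    refine hratio (((W m).map ρ).prod * ρ e ^ k * Λ) _ _ (by positivity) measurableSet_Icc measurableSet_Icc
      ?_ ?_ ?_ ?_ hνpos
    · refine Icc_subset_Icc_left ?_
      -- `y ≤ Ψ_e y` because `Ψ_e` fixes `1` and contracts.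
      have h2 : y ≤ wordMap ρ t [e] y := by
        have := wordMap_sub (ρ := ρ) (t := t) [e] 1 y
        simp only [wordMap, he1, List.map_cons, List.map_nil, List.prod_singleton] at this ⊢
        nlinarith [hρ01 e]
      have h3 : L (W m) (k + 1) = L (W m) k ++ [e] := by
        simp [L, List.replicate_succ']
      rw [h3, wordMap_append (L (W m) k)]
      exact (wordMap_strictMono hρ' _).monotone h2
    · intro x hx z hz
      have h1 := wordMap_sub (ρ := ρ) (t := t) (L (W m) k) 1 y
      have h2 := wordMap_sub (ρ := ρ) (t := t) (R (W m) (l k)) y' 0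
      rw [hLprod] at h1
      rw [hRprod, ← hmid _ k] at h2
      have hfl : ρ f ^ l k ≤ ρ e ^ k / ρ f := by
        rw [le_div_iff₀ hfk, ← pow_succ]
        exact (hl1 k).le
      have h3 : ((W m).map ρ).prod * (ρ i * ρ e ^ k) * (1 - y)
          ≤ ((W m).map ρ).prod * (1 * ρ e ^ k) * 1 := by
        gcongr
        · exact (hρ01 i).2.le
        · linarith
      have h4 : ((W m).map ρ).prod * (ρ j * ρ f ^ l k) * (y' - 0)
          ≤ ((W m).map ρ).prod * (1 * (ρ e ^ k / ρ f)) * 1 := by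
        gcongr
        · exact (hρ01 j).2.le
        · linarith
      have h5 : ((W m).map ρ).prod * ρ e ^ k * Λ
          = ((W m).map ρ).prod * (1 * ρ e ^ k) * 1
            + ((W m).map ρ).prod * (1 * (ρ e ^ k / ρ f)) * 1 := by
        rw [hΛ]; ring
      rw [abs_le]
      constructor <;> linarith [hx.1, hx.2, hz.1, hz.2]
    · rw [hκ]
      refine hsep _ _ _ _ (hκL.trans ?_) hκR
      gcongr
    · rw [hκ]
      exact hsep _ _ _ _ (by rwa [pow_succ]) hκR
  obtain ⟨k, -, k', -, hkk, heq⟩ := Set.infinite_univ.exists_ne_map_eq_of_mapsTo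
    (fun k _ => hmem k) hΓ
  have hrel := mul_eq_mul_of_ratio_eq (mul_pos (hp' i) hα0) (mul_pos (hp' j) hβ0) (hp01 e).2.ne
    (pow_pos (hp' e) k) (pow_pos (hp' e) k') (pow_pos (hp' f) (l k)) (pow_pos (hp' f) (l k')) heq
  obtain ⟨q, hq⟩ := exists_rat_log_div_log (hp' f) (hp' e) (hp01 e).2 hkk hrel
  refine ⟨q, ?_⟩
  rw [← hq, hp, Real.log_rpow (hρ' f), Real.log_rpow (hρ' e), mul_div_mul_left _ _ hs.ne']
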